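/- For $q>0$ and $x>0$ let $$\Gamma_q(x)=(1-q)^{1-x}\prod_{n=0}^\infty\frac{1-q^{n+1}}{1-q^{n+x}}\quad(0<q<1),\qquad \Gamma_q(x)=(q-1)^{1-x}q^{x(x-1)/2}\prod_{n=0}^\infty\frac{1-q^{-(n+1)}}{1-q^{-(n+x)}}\quad(q>1),$$ and let $\Gamma_1=\Gamma$ be Euler's gamma function. Let $\psi_q(x)=\Gamma_q'(x)/\Gamma_q(x)$ be the $q$-digamma function, where the derivative is taken with respect to $x$. Then for all $q>0$ and all $x>0$, $$\psi_q(x)\,\psi_q\!\left(\tfrac1x\right)\le\bigl(\psi_q(1)\bigr)^2 .$$ -/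

import Mathlib

/-- The `q`-gamma function `Γ_q(x)` for `q > 0` and `x > 0`; for `q = 1` it is Euler's `Γ`. -/
noncomputable def qGamma (q x : ℝ) : ℝ :=
  if q < 1 then
    (1 - q) ^ (1 - x) * ∏' n : ℕ, (1 - q ^ ((n : ℝ) + 1)) / (1 - q ^ ((n : ℝ) + x))
  else if q = 1 then
    Real.Gamma x
  else
    (q - 1) ^ (1 - x) * q ^ (x * (x - 1) / 2) *
      ∏' n : ℕ, (1 - q ^ (-((n : ℝ) + 1))) / (1 - q ^ (-((n : ℝ) + x)))

/-- The `q`-digamma function `ψ_q(x) = Γ_q'(x) / Γ_q(x)`, the derivative being in `x`. -/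
noncomputable def qDigamma (q x : ℝ) : ℝ :=
  deriv (qGamma q) x / qGamma q x

/-!
With `h = |log q|` and `p = e^{-h}`, term-by-term differentiation of the logarithm of the product
gives, for all `q ≠ 1`,
`-ψ_q(x) = ∑ n, h / (e^{h(n+x)} - 1) + log (1 - p) - [q > 1] h (x - 3/2)`,
and for `q = 1` the analogous series of `1 / (n + x) - log ((n + 2) / (n + 1))`. The constant
`log (1 - p)` is distributed over the terms as `-∑ n, log ((1 - p^{n+2}) / (1 - p^{n+1}))`. The
inequality is then proved for every partial sum `F` of `-ψ_q` and passes to the limit.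

A partial sum `F` is antitone with `F(1) ≥ 0`, so only those `x` matter at which `F(x)` and `F(1/x)`
are both positive. For these it suffices to find a positive function `u` with
`u(1)² ≤ u(x) u(1/x)` and constants `A`, `b` with `b ≥ 0` such that `F ≤ A / u - b`, with equality
at `1`: the two numerators `A - b u` are then bounded by AM-GM
(`mul_inv_le_sq_of_le_div_sub`). Equivalently, `u F` lies below its tangent at `1` as a function
of `u`, and this tangent is nonincreasing.

* For `q < 1` take `u(x) = e^{hx} - 1`. The hypothesis on `u` is Cauchy-Schwarz for the exponential
  series (`exp_sub_one_sq_le_mul`), and `u` times each term is a concave Möbius function of `u`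
  (`qKernel_le_tangent`).
* For `q = 1` take `u(x) = x`, where the terms `x / (n + x)` are concave.
* For `q > 1` take `u(x) = x` as well. The terms `x h / (e^{h(n+x)} - 1)` need not be concave, but
  their second derivatives add up to at most `2h` for `x ≥ 1/2` (`sum_deriv2_mul_qKernel_le`),
  which the summand `-h x (x - 3/2)` compensates. Positivity of `F` at `x` and `1/x` confines `x` to
  `(1/2, 2)`.
-/


/-! ### Products of majorants at reciprocal points -/

/-- Here `u`, `v`, `w` stand for the values of a function at `x`, `1 / x` and `1`. If `w` is at
most the geometric mean of `u` and `v`, then the majorant `t ↦ A / t - b` reverses the inequality. -/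
theorem mul_le_sq_of_le_div_sub {u v w A b : ℝ} (hu : 0 < u) (hv : 0 < v) (hw : 0 < w)
    (huv : w ^ 2 ≤ u * v) (hb : 0 ≤ b) {y z : ℝ} (hy : 0 ≤ y) (hz : 0 ≤ z)
    (hyu : y ≤ A / u - b) (hzv : z ≤ A / v - b) : y * z ≤ (A / w - b) ^ 2 := by
  have h1 : A / u - b = (A - b * u) / u := by field_simp
  have h2 : A / v - b = (A - b * v) / v := by field_simp
  have h3 : A / w - b = (A - b * w) / w := by field_simp
  have p1 : 0 ≤ A - b * u := by
    have : 0 ≤ (A - b * u) / u := by rw [← h1]; linarith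
    rwa [le_div_iff₀ hu, zero_mul] at this
  have p2 : 0 ≤ A - b * v := by
    have : 0 ≤ (A - b * v) / v := by rw [← h2]; linarith
    rwa [le_div_iff₀ hv, zero_mul] at this
  have hs : 2 * w ≤ u + v := by
    nlinarith [sq_nonneg (u - v)]
  -- AM-GM turns the product of the numerators into the square of their mean.
  have h4 : (A - b * u) * (A - b * v) ≤ (A - b * w) ^ 2 := by
    have m0 : 0 ≤ (A - b * u + (A - b * v)) / 2 := by linarith
    have m1 : (A - b * u + (A - b * v)) / 2 ≤ A - b * w := by nlinarith
    calc (A - b * u) * (A - b * v) ≤ ((A - b * u + (A - b * v)) / 2) ^ 2 := by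
          nlinarith [sq_nonneg ((A - b * u) - (A - b * v))]
      _ ≤ _ := pow_le_pow_left₀ m0 m1 2
  calc y * z ≤ (A / u - b) * (A / v - b) := by gcongr; linarith
    _ = (A - b * u) * (A - b * v) / (u * v) := by rw [h1, h2]; field_simp
    _ ≤ (A - b * w) ^ 2 / w ^ 2 := by gcongr
    _ = _ := by rw [h3]; field_simp

/-- The form in which the majorant is applied to an antitone `F`: it is needed only where both
`F x` and `F (1 / x)` are positive, since the product is nonpositive otherwise. -/
theorem mul_inv_le_sq_of_le_div_sub {F u : ℝ → ℝ} {A b : ℝ} (hF : AntitoneOn F (Set.Ioi 0))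
    (hF1 : 0 ≤ F 1) (hu : ∀ x, 0 < x → 0 < u x)
    (huu : ∀ x, 0 < x → u 1 ^ 2 ≤ u x * u (1 / x)) (hb : 0 ≤ b) (h1 : F 1 = A / u 1 - b)
    (h : ∀ x, 0 < x → 0 < F x → 0 < F (1 / x) → F x ≤ A / u x - b) {x : ℝ} (hx : 0 < x) :
    F x * F (1 / x) ≤ F 1 ^ 2 := by
  have key : ∀ x, 1 ≤ x → F x * F (1 / x) ≤ F 1 ^ 2 := by
    intro x hx1
    have hx : 0 < x := by linarith
    have hx' : 0 < 1 / x := by positivity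
    have hle : 1 / x ≤ 1 := by rw [div_le_one hx]; exact hx1
    have hF' : F 1 ≤ F (1 / x) := hF hx' (by simp) hle
    rcases le_or_gt (F x) 0 with hn | hp
    · exact (mul_nonpos_of_nonpos_of_nonneg hn (hF1.trans hF')).trans (sq_nonneg _)
    · have hp' : 0 < F (1 / x) := hp.trans_le (hF hx' hx (hle.trans hx1))
      rw [h1]
      refine mul_le_sq_of_le_div_sub (hu x hx) (hu _ hx') (hu 1 one_pos) (huu x hx) hb hp.le hp'.le
        (h x hx hp hp') (h _ hx' hp' ?_)
      rwa [one_div_one_div]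
  rcases le_total 1 x with h1x | h1x
  · exact key x h1x
  · have := key (1 / x) (by rw [le_div_iff₀ hx]; linarith)
    rwa [one_div_one_div, mul_comm] at this

/-- Cauchy-Schwarz for the power series of `exp (h * x) - 1`, in powers of `x` and of `1 / x`. -/
theorem exp_sub_one_sq_le_mul {h x : ℝ} (hh : 0 < h) (hx : 0 < x) :
    (Real.exp (h * 1) - 1) ^ 2 ≤ (Real.exp (h * x) - 1) * (Real.exp (h * (1 / x)) - 1) := by
  have lim : ∀ y : ℝ, Filter.Tendsto
      (fun N : ℕ => ∑ i ∈ Finset.range N, y ^ (i + 1) / ((i + 1).factorial : ℝ)) Filter.atTop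
      (nhds (Real.exp y - 1)) := by
    intro y
    have h1 := NormedSpace.expSeries_div_hasSum_exp (𝔸 := ℝ) y
    rw [← Real.exp_eq_exp_ℝ] at h1
    have h2 := (hasSum_nat_add_iff' 1).2 h1
    simpa using h2.tendsto_sum_nat
  refine le_of_tendsto_of_tendsto' ((lim _).pow 2) ((lim _).mul (lim _)) fun N => ?_
  refine Finset.sum_sq_le_sum_mul_sum_of_sq_le_mul _ (fun i _ => by positivity)
    (fun i _ => by positivity) fun i _ => le_of_eq ?_
  rw [div_pow, div_mul_div_comm, ← mul_pow, ← sq]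
  congr 1
  rw [← pow_mul, mul_comm (i + 1) 2, pow_mul]
  congr 1
  field_simp

/-! ### The terms of the series for the q-digamma function -/

/-- For `q = e^{-h}` the terms of the series of `-ψ_q` at `x` are the values of this function at
`n + x`, up to constants: `h q ^ s / (1 - q ^ s) = h / (e^{h s} - 1)`. -/
noncomputable def qKernel (h s : ℝ) : ℝ := h / (Real.exp (h * s) - 1)

/-- The increments `log (1 - q^{n+2}) - log (1 - q^{n+1})` with `q = e^{-h}`; they sum to
`-log (1 - q)`. -/
noncomputable def qLogStep (h : ℝ) (n : ℕ) : ℝ :=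
  Real.log ((1 - Real.exp (-(h * (n + 2)))) / (1 - Real.exp (-(h * (n + 1)))))

/-- The partial sums of a series for `-ψ_q`, `q = e^{-h} < 1`. The constant `-log (1 - q)` is
distributed over the terms so that inequalities can be checked term by term. -/
noncomputable def qPartial (h : ℝ) (N : ℕ) (x : ℝ) : ℝ :=
  ∑ n ∈ Finset.range N, (qKernel h (n + x) - qLogStep h n)

theorem exp_mul_sub_one_pos {h s : ℝ} (hh : 0 < h) (hs : 0 < s) : 0 < Real.exp (h * s) - 1 := by
  have := Real.add_one_lt_exp (mul_pos hh hs).ne'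
  have := mul_pos hh hs
  linarith

theorem qKernel_pos {h s : ℝ} (hh : 0 < h) (hs : 0 < s) : 0 < qKernel h s :=
  div_pos hh (exp_mul_sub_one_pos hh hs)

theorem qKernel_le_qKernel {h s t : ℝ} (hh : 0 < h) (hs : 0 < s) (hst : s ≤ t) :
    qKernel h t ≤ qKernel h s := by
  unfold qKernel
  have := exp_mul_sub_one_pos hh hs
  gcongr

theorem qPartial_antitoneOn {h : ℝ} (hh : 0 < h) (N : ℕ) :
    AntitoneOn (qPartial h N) (Set.Ioi 0) := by
  intro x hx y _ hxy
  refine Finset.sum_le_sum fun n _ => ?_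
  have : (0 : ℝ) < n + x := by have : 0 < x := hx; positivity
  have := qKernel_le_qKernel hh this (show (n : ℝ) + x ≤ n + y by linarith)
  linarith

/-- The increments in terms of `w = e^{h(n+1)}` and `E = e^h`. -/
theorem qLogStep_eq (h : ℝ) (n : ℕ) :
    qLogStep h n = Real.log ((Real.exp (h * (n + 1)) * Real.exp h - 1) /
      (Real.exp h * (Real.exp (h * (n + 1)) - 1))) := by
  unfold qLogStep
  have h2 : Real.exp (-(h * (n + 2))) = (Real.exp (h * (n + 1)) * Real.exp h)⁻¹ := by
    rw [← Real.exp_add, ← Real.exp_neg]; ring_nf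
  rw [h2, Real.exp_neg]
  have := Real.exp_pos h
  have := Real.exp_pos (h * (n + 1))
  congr 1
  by_cases h0 : Real.exp (h * (n + 1)) - 1 = 0
  · have : Real.exp (h * (n + 1)) = 1 := by linarith
    simp [this]
  · have : 1 - (Real.exp (h * (n + 1)))⁻¹ ≠ 0 := by
      intro h3
      rw [sub_eq_zero, eq_comm, inv_eq_one] at h3
      exact h0 (by linarith)
    field_simp

/-- Lower bound `log r ≥ 1 - 1 / r` for the increments. -/
theorem div_le_qLogStep {h : ℝ} (hh : 0 < h) (n : ℕ) :
    (Real.exp h - 1) / (Real.exp (h * (n + 1)) * Real.exp h - 1) ≤ qLogStep h n := by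
  have hw := exp_mul_sub_one_pos hh (show (0 : ℝ) < n + 1 by positivity)
  have hE : 1 < Real.exp h := by simpa using hh
  rw [qLogStep_eq]
  set w := Real.exp (h * (n + 1))
  set E := Real.exp h
  have hwE : 0 < w * E - 1 := by nlinarith
  have hpos : 0 < (w * E - 1) / (E * (w - 1)) := by positivity
  refine le_trans (le_of_eq ?_) (Real.one_sub_inv_le_log_of_pos hpos)
  rw [inv_div, eq_sub_iff_add_eq, ← add_div, div_eq_one_iff_eq hwE.ne']
  ring

theorem qKernel_add_two_le_qLogStep {h : ℝ} (hh : 0 < h) (n : ℕ) :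
    qKernel h (n + 2) ≤ qLogStep h n := by
  refine le_trans ?_ (div_le_qLogStep hh n)
  have e : Real.exp (h * (n + 2)) = Real.exp (h * (n + 1)) * Real.exp h := by
    rw [← Real.exp_add]; ring_nf
  have := exp_mul_sub_one_pos hh (show (0 : ℝ) < n + 2 by positivity)
  unfold qKernel
  rw [e] at *
  have := Real.add_one_le_exp h
  gcongr
  linarith

theorem qLogStep_le_qKernel {h : ℝ} (hh : 0 < h) (n : ℕ) :
    qLogStep h n ≤ qKernel h (n + 1) := by
  have hw := exp_mul_sub_one_pos hh (show (0 : ℝ) < n + 1 by positivity)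
  have hE : 1 < Real.exp h := by simpa using hh
  have hi := Real.one_sub_le_exp_neg h
  rw [Real.exp_neg] at hi
  rw [qLogStep_eq, qKernel]
  set w := Real.exp (h * (n + 1))
  set E := Real.exp h
  have hwE : 0 < w * E - 1 := by nlinarith
  have hpos : 0 < (w * E - 1) / (E * (w - 1)) := by positivity
  refine (Real.log_le_sub_one_of_pos hpos).trans ?_
  have : (w * E - 1) / (E * (w - 1)) - 1 = (1 - E⁻¹) / (w - 1) := by field_simp; ring
  rw [this]
  gcongr
  linarith

theorem qPartial_one_nonneg {h : ℝ} (hh : 0 < h) (N : ℕ) : 0 ≤ qPartial h N 1 :=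
  Finset.sum_nonneg fun n _ => sub_nonneg.2 (qLogStep_le_qKernel hh n)

/-! ### The case `q < 1` -/

/-- As a function of `u = e^{hx} - 1`, the product `u * qKernel h (n + x)` is a concave Möbius
function; this is its tangent at `x = 1`, with equality there. -/
theorem qKernel_le_tangent {h x : ℝ} (hh : 0 < h) (hx : 0 < x) (n : ℕ) :
    qKernel h (n + x) ≤
      (h * Real.exp (h * n) * (Real.exp (h * 1) - 1) ^ 2 / (Real.exp (h * (n + 1)) - 1) ^ 2) /
        (Real.exp (h * x) - 1) +
      h * (Real.exp (h * n) - 1) / (Real.exp (h * (n + 1)) - 1) ^ 2 := by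
  have hu := exp_mul_sub_one_pos hh hx
  have hd := exp_mul_sub_one_pos hh (show (0 : ℝ) < n + x by positivity)
  have hD := exp_mul_sub_one_pos hh (show (0 : ℝ) < n + 1 by positivity)
  have hr : 1 ≤ Real.exp (h * n) := Real.one_le_exp (by positivity)
  have e1 : Real.exp (h * (n + x)) = Real.exp (h * n) * Real.exp (h * x) := by
    rw [← Real.exp_add]; ring_nf
  have e2 : Real.exp (h * (n + 1)) = Real.exp (h * n) * Real.exp (h * 1) := by
    rw [← Real.exp_add]; ring_nf
  unfold qKernel
  rw [e1] at hd ⊢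
  rw [e2] at hD ⊢
  set r := Real.exp (h * n)
  set a := Real.exp (h * x)
  set E := Real.exp (h * 1)
  rw [div_div, div_add_div _ _ (by positivity) (by positivity), div_le_div_iff₀ hd (by positivity)]
  have : 0 ≤ (h * (r * E - 1) ^ 2) * ((r - 1) * r * (a - E) ^ 2) := by
    have : 0 ≤ r - 1 := by linarith
    positivity
  nlinarith [this]

theorem qKernel_one_eq_tangent {h : ℝ} (hh : 0 < h) (n : ℕ) :
    qKernel h (n + 1) =
      (h * Real.exp (h * n) * (Real.exp (h * 1) - 1) ^ 2 / (Real.exp (h * (n + 1)) - 1) ^ 2) /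
        (Real.exp (h * 1) - 1) +
      h * (Real.exp (h * n) - 1) / (Real.exp (h * (n + 1)) - 1) ^ 2 := by
  have hu := exp_mul_sub_one_pos hh one_pos
  have hD := exp_mul_sub_one_pos hh (show (0 : ℝ) < n + 1 by positivity)
  have e2 : Real.exp (h * (n + 1)) = Real.exp (h * n) * Real.exp (h * 1) := by
    rw [← Real.exp_add]; ring_nf
  unfold qKernel
  rw [e2] at hD ⊢
  set r := Real.exp (h * n)
  set E := Real.exp (h * 1)
  have hne : r * E - 1 ≠ 0 := hD.ne'
  rw [div_div, div_add_div _ _ (by positivity) (by positivity),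
    div_eq_div_iff (by positivity) (by positivity)]
  ring

theorem tangent_slope_le_qLogStep {h : ℝ} (hh : 0 < h) (n : ℕ) :
    h * (Real.exp (h * n) - 1) / (Real.exp (h * (n + 1)) - 1) ^ 2 ≤ qLogStep h n := by
  refine le_trans ?_ (div_le_qLogStep hh n)
  have hD := exp_mul_sub_one_pos hh (show (0 : ℝ) < n + 1 by positivity)
  have hr : 1 ≤ Real.exp (h * n) := Real.one_le_exp (by positivity)
  have hE : 1 < Real.exp h := by simpa using hh
  have hh' := Real.add_one_le_exp h
  rw [mul_add, Real.exp_add, mul_one] at *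
  set r := Real.exp (h * n)
  set E := Real.exp h
  have hwE : 0 < r * E * E - 1 := by nlinarith
  rw [div_le_div_iff₀ (by positivity) hwE]
  have h1 : (r - 1) * (r * E * E - 1) ≤ (r * E - 1) ^ 2 := by nlinarith [sq_nonneg (E - 1)]
  have h0 : 0 ≤ (r - 1) * (r * E * E - 1) := mul_nonneg (by linarith) hwE.le
  calc h * (r - 1) * (r * E * E - 1) = h * ((r - 1) * (r * E * E - 1)) := by ring
    _ ≤ (E - 1) * ((r - 1) * (r * E * E - 1)) := by gcongr; linarith
    _ ≤ _ := by gcongr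

theorem qPartial_mul_le_sq {h x : ℝ} (hh : 0 < h) (hx : 0 < x) (N : ℕ) :
    qPartial h N x * qPartial h N (1 / x) ≤ qPartial h N 1 ^ 2 := by
  refine mul_inv_le_sq_of_le_div_sub (u := fun x => Real.exp (h * x) - 1)
    (A := ∑ n ∈ Finset.range N,
      h * Real.exp (h * n) * (Real.exp (h * 1) - 1) ^ 2 / (Real.exp (h * (n + 1)) - 1) ^ 2)
    (b := ∑ n ∈ Finset.range N,
      (qLogStep h n - h * (Real.exp (h * n) - 1) / (Real.exp (h * (n + 1)) - 1) ^ 2))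
    (qPartial_antitoneOn hh N) (qPartial_one_nonneg hh N) (fun y hy => exp_mul_sub_one_pos hh hy)
    (fun y hy => exp_sub_one_sq_le_mul hh hy)
    (Finset.sum_nonneg fun n _ => sub_nonneg.2 (tangent_slope_le_qLogStep hh n)) ?_ ?_ hx
  · rw [Finset.sum_div, ← Finset.sum_sub_distrib]
    refine Finset.sum_congr rfl fun n _ => ?_
    rw [qKernel_one_eq_tangent hh n]
    ring
  · intro y hy _ _
    rw [Finset.sum_div, ← Finset.sum_sub_distrib]
    refine Finset.sum_le_sum fun n _ => ?_
    have := qKernel_le_tangent hh hy n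
    linarith

/-! ### The case `q = 1` -/

/-- The partial sums of a series for `-ψ`: the logarithms add up to `log (N + 1)`, which makes the
divergent harmonic-type sum converge. -/
noncomputable def digammaPartial (N : ℕ) (x : ℝ) : ℝ :=
  ∑ n ∈ Finset.range N, (1 / ((n : ℝ) + x) - Real.log (((n : ℝ) + 2) / (n + 1)))

theorem digammaPartial_mul_le_sq {x : ℝ} (hx : 0 < x) (N : ℕ) :
    digammaPartial N x * digammaPartial N (1 / x) ≤ digammaPartial N 1 ^ 2 := by
  refine mul_inv_le_sq_of_le_div_sub (u := fun x => x)
    (A := ∑ n ∈ Finset.range N, 1 / ((n : ℝ) + 1) ^ 2)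
    (b := ∑ n ∈ Finset.range N, (Real.log (((n : ℝ) + 2) / (n + 1)) - n / ((n : ℝ) + 1) ^ 2))
    ?_ ?_ (fun y hy => hy) ?_ ?_ ?_ ?_ hx
  · intro y hy z _ hyz
    have hy : 0 < y := hy
    unfold digammaPartial
    gcongr
  · refine Finset.sum_nonneg fun n _ => sub_nonneg.2 ?_
    refine (Real.log_le_sub_one_of_pos (by positivity)).trans (le_of_eq ?_)
    field_simp
    ring
  · intro y hy
    field_simp
    norm_num
  · refine Finset.sum_nonneg fun n _ => sub_nonneg.2 ?_
    refine le_trans ?_ (Real.one_sub_inv_le_log_of_pos (by positivity))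
    have : 1 - (((n : ℝ) + 2) / (n + 1))⁻¹ = 1 / (n + 2) := by field_simp; ring
    rw [this, div_le_div_iff₀ (by positivity) (by positivity)]
    nlinarith
  · rw [Finset.sum_div, ← Finset.sum_sub_distrib]
    refine Finset.sum_congr rfl fun n _ => ?_
    field_simp
    ring
  · intro y hy _ _
    rw [Finset.sum_div, ← Finset.sum_sub_distrib]
    refine Finset.sum_le_sum fun n _ => ?_
    have : 1 / ((n : ℝ) + y) ≤ 1 / ((n : ℝ) + 1) ^ 2 / y + n / ((n : ℝ) + 1) ^ 2 := by
      rw [div_div, div_add_div _ _ (by positivity) (by positivity),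
        div_le_div_iff₀ (by positivity) (by positivity)]
      have : 0 ≤ ((n : ℝ) + 1) ^ 2 * (n * (y - 1) ^ 2) := by positivity
      nlinarith [this]
    linarith

/-! ### The case `q > 1` -/

/-- The inequality `2 cosh y - 2 ≥ y ^ 2 + y ^ 4 / 12`, multiplied by `exp y`. -/
theorem exp_mul_le_exp_sub_one_sq (y : ℝ) :
    Real.exp y * (y ^ 2 + y ^ 4 / 12) ≤ (Real.exp y - 1) ^ 2 := by
  have h1 : ∑ n ∈ Finset.range 3, y ^ (2 * n) / ((2 * n).factorial : ℝ) ≤ Real.cosh y :=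
    sum_le_hasSum _ (fun n _ => by rw [pow_mul]; positivity) (Real.hasSum_cosh y)
  have h2 : y ^ 2 + y ^ 4 / 12 ≤ 2 * Real.cosh y - 2 := by
    norm_num [Finset.sum_range_succ, Nat.factorial] at h1
    linarith
  have h3 : (Real.exp y - 1) ^ 2 = Real.exp y * (2 * Real.cosh y - 2) := by
    rw [Real.cosh_eq, Real.exp_neg]
    field_simp
    ring
  rw [h3]
  gcongr

theorem hasDerivAt_exp_mul_add (h a x : ℝ) :
    HasDerivAt (fun x => Real.exp (h * (a + x))) (h * Real.exp (h * (a + x))) x := by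
  have := (((hasDerivAt_id x).const_add a).const_mul h).exp
  simpa [mul_comm] using this

theorem hasDerivAt_mul_qKernel {h a x : ℝ} (hh : 0 < h) (hx : 0 < a + x) :
    HasDerivAt (fun x => x * qKernel h (a + x))
      (h / (Real.exp (h * (a + x)) - 1) -
        h ^ 2 * x * Real.exp (h * (a + x)) / (Real.exp (h * (a + x)) - 1) ^ 2) x := by
  have hw := exp_mul_sub_one_pos hh hx
  have := (hasDerivAt_id x).mul
    ((hasDerivAt_const x h).div ((hasDerivAt_exp_mul_add h a x).sub_const 1) hw.ne')
  refine this.congr_deriv ?_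
  simp only [id, Pi.div_apply]
  field_simp
  ring

theorem hasDerivAt_deriv_mul_qKernel {h a x : ℝ} (hh : 0 < h) (hx : 0 < a + x) :
    HasDerivAt (fun x => h / (Real.exp (h * (a + x)) - 1) -
        h ^ 2 * x * Real.exp (h * (a + x)) / (Real.exp (h * (a + x)) - 1) ^ 2)
      (h ^ 2 * Real.exp (h * (a + x)) *
        (h * x * (Real.exp (h * (a + x)) + 1) - 2 * (Real.exp (h * (a + x)) - 1)) /
        (Real.exp (h * (a + x)) - 1) ^ 3) x := by
  have hw := exp_mul_sub_one_pos hh hx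
  have he := hasDerivAt_exp_mul_add h a x
  have := ((hasDerivAt_const x h).div (he.sub_const 1) hw.ne').sub
    ((((hasDerivAt_id x).const_mul (h ^ 2)).mul he).div ((he.sub_const 1).pow 2)
      (pow_ne_zero 2 hw.ne'))
  refine this.congr_deriv ?_
  simp only [id, Pi.mul_apply, Pi.pow_apply]
  generalize Real.exp (h * (a + x)) = w at *
  obtain ⟨v, rfl⟩ : ∃ v, w = v + 1 := ⟨w - 1, by ring⟩
  rw [add_sub_cancel_right] at *
  norm_num
  field_simp
  ring

/-- The second derivative of `x * qKernel h x` is at most `h` on `[1/2, ∞)`. -/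
theorem deriv2_mul_qKernel_le {h x : ℝ} (hh : 0 < h) (hx : 1 / 2 ≤ x) :
    h ^ 2 * Real.exp (h * x) *
        (h * x * (Real.exp (h * x) + 1) - 2 * (Real.exp (h * x) - 1)) /
        (Real.exp (h * x) - 1) ^ 3 ≤ h := by
  have hx0 : 0 < x := by linarith
  have hw := exp_mul_sub_one_pos hh hx0
  have hc := exp_mul_le_exp_sub_one_sq (h * x)
  have hq := Real.quadratic_le_exp_of_nonneg (mul_pos hh hx0).le
  have hy : 0 < h * x := mul_pos hh hx0
  have hhy : h ≤ 2 * (h * x) := by nlinarith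
  have hwp := Real.exp_pos (h * x)
  generalize h * x = y at *
  set w := Real.exp y
  have h1 : (2 + y) * (y * (w + 1) - 2 * (w - 1)) ≤ (w - 1) * y ^ 2 := by nlinarith
  have h2 : h ≤ (2 + y) * (1 + y ^ 2 / 12) := by nlinarith [sq_nonneg (y - 2), pow_pos hy 3]
  rw [div_le_iff₀ (by positivity)]
  have h3 : h * ((2 + y) * (w * (y * (w + 1) - 2 * (w - 1)))) ≤ (2 + y) * (w - 1) ^ 3 :=
    calc h * ((2 + y) * (w * (y * (w + 1) - 2 * (w - 1))))
        = h * w * ((2 + y) * (y * (w + 1) - 2 * (w - 1))) := by ring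
      _ ≤ h * w * ((w - 1) * y ^ 2) := by gcongr
      _ = h * ((w - 1) * (w * y ^ 2)) := by ring
      _ ≤ ((2 + y) * (1 + y ^ 2 / 12)) * ((w - 1) * (w * y ^ 2)) := by gcongr
      _ = (2 + y) * (w - 1) * (w * (y ^ 2 + y ^ 4 / 12)) := by ring
      _ ≤ (2 + y) * (w - 1) * (w - 1) ^ 2 := by gcongr
      _ = _ := by ring
  have h4 : h * (w * (y * (w + 1) - 2 * (w - 1))) ≤ (w - 1) ^ 3 := by
    refine le_of_mul_le_mul_left ?_ (show 0 < 2 + y by linarith)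
    linarith
  calc h ^ 2 * w * (y * (w + 1) - 2 * (w - 1))
      = h * (h * (w * (y * (w + 1) - 2 * (w - 1)))) := by ring
    _ ≤ h * (w - 1) ^ 3 := by gcongr

/-- The second derivatives of the later terms `x * qKernel h (a + x)`, `a ≥ 1`, have a telescoping
bound. -/
theorem deriv2_mul_qKernel_add_le {h a x : ℝ} (hh : 0 < h) (ha : 1 ≤ a) (hx : 0 < x) :
    h ^ 2 * Real.exp (h * (a + x)) *
        (h * x * (Real.exp (h * (a + x)) + 1) - 2 * (Real.exp (h * (a + x)) - 1)) /
        (Real.exp (h * (a + x)) - 1) ^ 3 ≤ h * x * (1 / (a - 1 + x) - 1 / (a + x)) := by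
  have hax : 0 < a + x := by linarith
  have hax' : 0 < a - 1 + x := by linarith
  have hw := exp_mul_sub_one_pos hh hax
  have hc := exp_mul_le_exp_sub_one_sq (h * (a + x))
  have hl := Real.add_one_le_exp (h * (a + x))
  have hy : 0 < h * (a + x) := mul_pos hh hax
  have hyx : h * x ≤ h * (a + x) := by gcongr; linarith
  have hwp := Real.exp_pos (h * (a + x))
  set w := Real.exp (h * (a + x))
  have h1 : h * x * (w + 1) - 2 * (w - 1) ≤ h * x * (w - 1) := by linarith
  have h2 : w * (h * (a + x)) ^ 2 ≤ (w - 1) ^ 2 := by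
    refine le_trans ?_ hc
    gcongr
    have : 0 ≤ (h * (a + x)) ^ 4 / 12 := by positivity
    linarith
  calc h ^ 2 * w * (h * x * (w + 1) - 2 * (w - 1)) / (w - 1) ^ 3
      ≤ h ^ 2 * w * (h * x * (w - 1)) / (w - 1) ^ 3 := by gcongr
    _ = h ^ 3 * x * w / (w - 1) ^ 2 := by field_simp
    _ ≤ h * x * (1 / (a + x) ^ 2) := by
        rw [mul_one_div, div_le_div_iff₀ (by positivity) (by positivity)]
        calc h ^ 3 * x * w * (a + x) ^ 2 = h * x * (w * (h * (a + x)) ^ 2) := by ring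
          _ ≤ _ := by gcongr
    _ ≤ _ := by
        gcongr
        rw [div_sub_div _ _ hax'.ne' hax.ne', div_le_div_iff₀ (by positivity) (by positivity)]
        nlinarith

theorem sum_deriv2_mul_qKernel_le {h x : ℝ} (hh : 0 < h) (hx : 1 / 2 ≤ x) (N : ℕ) :
    ∑ n ∈ Finset.range (N + 1), h ^ 2 * Real.exp (h * (n + x)) *
        (h * x * (Real.exp (h * (n + x)) + 1) - 2 * (Real.exp (h * (n + x)) - 1)) /
        (Real.exp (h * (n + x)) - 1) ^ 3 ≤ 2 * h - h * x * (1 / (N + x)) := by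
  have hx0 : 0 < x := by linarith
  induction N with
  | zero =>
    have h1 := deriv2_mul_qKernel_le hh hx
    have h2 : h * x * (1 / x) = h := by field_simp
    simp only [zero_add, Finset.sum_range_one, Nat.cast_zero]
    linarith
  | succ N ih =>
    rw [Finset.sum_range_succ]
    have h1 := deriv2_mul_qKernel_add_le hh
      (show (1 : ℝ) ≤ (N + 1 : ℕ) by push_cast; linarith [(N.cast_nonneg : (0 : ℝ) ≤ N)]) hx0
    have h2 : ((N + 1 : ℕ) : ℝ) - 1 = N := by push_cast; ring
    rw [h2] at h1
    linarith

/-- The tangent to the convex function `qKernel h` at `n + 1` lies below its value at `n + 2`. -/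
theorem deriv_mul_qKernel_one_le {h : ℝ} (hh : 0 < h) (n : ℕ) :
    h / (Real.exp (h * (n + 1)) - 1) -
        h ^ 2 * 1 * Real.exp (h * (n + 1)) / (Real.exp (h * (n + 1)) - 1) ^ 2 ≤
      qKernel h (n + 2) := by
  have e : Real.exp (h * (n + 2)) = Real.exp (h * (n + 1)) * Real.exp h := by
    rw [← Real.exp_add]; ring_nf
  have hw2 := exp_mul_sub_one_pos hh (show (0 : ℝ) < n + 2 by positivity)
  have hw := exp_mul_sub_one_pos hh (show (0 : ℝ) < n + 1 by positivity)
  have hE : 1 < Real.exp h := by simpa using hh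
  have hi := Real.one_sub_le_exp_neg h
  rw [Real.exp_neg] at hi
  unfold qKernel
  rw [e] at *
  set w := Real.exp (h * (n + 1))
  set E := Real.exp h
  have hE' : E - 1 ≤ h * E := by
    have : E * (1 - h) ≤ E * E⁻¹ := by gcongr
    rw [mul_inv_cancel₀ (by positivity)] at this
    linarith
  rw [sub_le_iff_le_add, div_add_div _ _ hw2.ne' (by positivity),
    div_le_div_iff₀ hw (by positivity)]
  have h1 : (E - 1) * (w - 1) ≤ h * (w * E - 1) := by
    calc (E - 1) * (w - 1) ≤ h * E * (w - 1) := by gcongr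
      _ = h * (w * E - E) := by ring
      _ ≤ _ := by gcongr
  have h2 : 0 ≤ (h * w * (w - 1)) * (h * (w * E - 1) - (E - 1) * (w - 1)) :=
    mul_nonneg (by positivity) (by linarith)
  nlinarith [h2]

theorem qPartial_two_nonpos {h : ℝ} (hh : 0 < h) (N : ℕ) : qPartial h N 2 ≤ 0 :=
  Finset.sum_nonpos fun n _ => sub_nonpos.2 (qKernel_add_two_le_qLogStep hh n)

/-- A concave differentiable function lies below its tangents. -/
theorem ConcaveOn.le_tangent_of_hasDerivAt {S : Set ℝ} {f : ℝ → ℝ} {x y f' : ℝ}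
    (hf : ConcaveOn ℝ S f) (hx : x ∈ S) (hy : y ∈ S) (hd : HasDerivAt f f' x) :
    f y ≤ f x + f' * (y - x) := by
  rcases lt_trichotomy x y with hlt | rfl | hlt
  · have := hf.slope_le_of_hasDerivAt hx hy hlt hd
    rw [slope_def_field, div_le_iff₀ (by linarith)] at this
    linarith
  · simp
  · have := hf.le_slope_of_hasDerivAt hy hx hlt hd
    rw [slope_def_field, le_div_iff₀ (by linarith)] at this
    linarith

/-- The partial sums of the series for `-ψ_q` with `q = e^h > 1`, multiplied by `x`, form a concave
function of `x` in `(1/2, 2)`: the linear term contributes `-2h` to the second derivative. -/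
theorem concaveOn_mul_qPartial_sub {h : ℝ} (hh : 0 < h) (N : ℕ) :
    ConcaveOn ℝ (Set.Ioo (1 / 2) 2)
      (fun x => x * (qPartial h (N + 1) x - h * (x - 3 / 2))) ∧
    ∀ x, 0 < x → HasDerivAt (fun x => x * (qPartial h (N + 1) x - h * (x - 3 / 2)))
      (∑ n ∈ Finset.range (N + 1), (h / (Real.exp (h * (n + x)) - 1) -
        h ^ 2 * x * Real.exp (h * (n + x)) / (Real.exp (h * (n + x)) - 1) ^ 2 - qLogStep h n)
        - h * (2 * x - 3 / 2)) x := by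
  have hd : ∀ x, 0 < x → HasDerivAt (fun x => x * (qPartial h (N + 1) x - h * (x - 3 / 2)))
      (∑ n ∈ Finset.range (N + 1), (h / (Real.exp (h * (n + x)) - 1) -
        h ^ 2 * x * Real.exp (h * (n + x)) / (Real.exp (h * (n + x)) - 1) ^ 2 - qLogStep h n)
        - h * (2 * x - 3 / 2)) x := by
    intro x hx
    have h1 : HasDerivAt (fun x => ∑ n ∈ Finset.range (N + 1),
        (x * qKernel h (n + x) - x * qLogStep h n) - h * (x ^ 2 - 3 / 2 * x))
        (∑ n ∈ Finset.range (N + 1), (h / (Real.exp (h * (n + x)) - 1) -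
        h ^ 2 * x * Real.exp (h * (n + x)) / (Real.exp (h * (n + x)) - 1) ^ 2 - 1 * qLogStep h n)
        - h * (2 * x - 3 / 2 * 1)) x := by
      refine HasDerivAt.sub (HasDerivAt.fun_sum fun n _ => ?_) ?_
      · exact (hasDerivAt_mul_qKernel hh (by positivity)).sub ((hasDerivAt_id x).mul_const _)
      · have h2 := hasDerivAt_pow 2 x
        simp only [Nat.cast_ofNat, Nat.add_one_sub_one, pow_one] at h2
        exact (h2.sub ((hasDerivAt_id x).const_mul _)).const_mul h
    simp only [one_mul, mul_one] at h1
    refine h1.congr_of_eventuallyEq (Filter.Eventually.of_forall fun y => ?_)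
    simp only [qPartial, mul_sub, Finset.mul_sum, Finset.sum_sub_distrib]
    ring
  refine ⟨?_, hd⟩
  refine concaveOn_of_hasDerivWithinAt2_nonpos (convex_Ioo _ _)
    (f' := fun x => ∑ n ∈ Finset.range (N + 1), (h / (Real.exp (h * (n + x)) - 1) -
        h ^ 2 * x * Real.exp (h * (n + x)) / (Real.exp (h * (n + x)) - 1) ^ 2 - qLogStep h n)
        - h * (2 * x - 3 / 2))
    (f'' := fun x => ∑ n ∈ Finset.range (N + 1), h ^ 2 * Real.exp (h * (n + x)) *
        (h * x * (Real.exp (h * (n + x)) + 1) - 2 * (Real.exp (h * (n + x)) - 1)) /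
        (Real.exp (h * (n + x)) - 1) ^ 3 - h * (2 * 1))
    (fun x hx => (hd x (by linarith [hx.1])).continuousAt.continuousWithinAt) ?_ ?_ ?_
  all_goals
    rw [interior_Ioo]
    intro x hx
    have hx0 : 0 < x := by linarith [hx.1]
  · exact (hd x hx0).hasDerivWithinAt
  · refine HasDerivAt.hasDerivWithinAt (HasDerivAt.sub (HasDerivAt.fun_sum fun n _ => ?_) ?_)
    · exact (hasDerivAt_deriv_mul_qKernel hh (by positivity)).sub_const _
    · exact (((hasDerivAt_id x).const_mul 2).sub_const _).const_mul h
  · have h1 := sum_deriv2_mul_qKernel_le hh hx.1.le N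
    have h2 : 0 ≤ h * x * (1 / (N + x)) := by positivity
    linarith

theorem qPartial_sub_mul_le_sq {h x : ℝ} (hh : 0 < h) (hx : 0 < x) (N : ℕ) :
    (qPartial h (N + 1) x - h * (x - 3 / 2)) * (qPartial h (N + 1) (1 / x) - h * (1 / x - 3 / 2)) ≤
      (qPartial h (N + 1) 1 - h * (1 - 3 / 2)) ^ 2 := by
  obtain ⟨hconc, hd⟩ := concaveOn_mul_qPartial_sub hh N
  have hd1 := hd 1 one_pos
  set D := ∑ n ∈ Finset.range (N + 1), (h / (Real.exp (h * (n + 1)) - 1) -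
        h ^ 2 * 1 * Real.exp (h * (n + 1)) / (Real.exp (h * (n + 1)) - 1) ^ 2 - qLogStep h n)
        - h * (2 * 1 - 3 / 2) with hD
  have hD0 : D ≤ 0 := by
    have : ∑ n ∈ Finset.range (N + 1), (h / (Real.exp (h * (n + 1)) - 1) -
        h ^ 2 * 1 * Real.exp (h * (n + 1)) / (Real.exp (h * (n + 1)) - 1) ^ 2 - qLogStep h n) ≤ 0 :=
      Finset.sum_nonpos fun n _ => sub_nonpos.2
        ((deriv_mul_qKernel_one_le hh n).trans (qKernel_add_two_le_qLogStep hh n))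
    linarith
  have hanti : AntitoneOn (fun x => qPartial h (N + 1) x - h * (x - 3 / 2)) (Set.Ioi 0) := by
    intro y hy z hz hyz
    have h1 := qPartial_antitoneOn hh (N + 1) hy hz hyz
    have h2 : h * (y - 3 / 2) ≤ h * (z - 3 / 2) := by gcongr
    simp only
    linarith
  -- Positivity of the partial sum at `z` forces `z < 2`, where concavity is available.
  have hlt : ∀ z, 0 < z → 0 < qPartial h (N + 1) z - h * (z - 3 / 2) → z < 2 := by
    intro z hz hpos
    by_contra hge
    have h1 := hanti (show (2 : ℝ) ∈ Set.Ioi 0 by simp) hz (not_lt.1 hge)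
    have h2 := qPartial_two_nonpos hh (N + 1)
    simp only at h1
    linarith
  refine mul_inv_le_sq_of_le_div_sub (F := fun x => qPartial h (N + 1) x - h * (x - 3 / 2))
    (u := fun x => x) (A := qPartial h (N + 1) 1 - h * (1 - 3 / 2) - D) (b := -D)
    hanti ?_ (fun y hy => hy) ?_ (by linarith) ?_ ?_ hx
  · have := qPartial_one_nonneg hh (N + 1)
    linarith
  · intro y hy
    field_simp
    norm_num
  · ring
  · intro y hy hp hp'
    have hy2 := hlt y hy hp
    have hy2' := hlt _ (by positivity) hp'
    have hy1 : 1 / 2 < y := by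
      rw [div_lt_iff₀ hy] at hy2'
      linarith
    have := hconc.le_tangent_of_hasDerivAt (show (1 : ℝ) ∈ Set.Ioo (1 / 2) 2 by norm_num)
      (show y ∈ Set.Ioo (1 / 2) 2 from ⟨hy1, hy2⟩) hd1
    rw [le_sub_iff_add_le, le_div_iff₀ hy]
    linarith

/-! ### Series for the q-digamma function -/

/-- If `Γ_q` is locally the exponential of `L`, then `ψ_q` is the derivative of `L`. -/
theorem qDigamma_eq_of_eventually_eq_exp {q x d : ℝ} {L : ℝ → ℝ}
    (hL : ∀ᶠ y in nhds x, qGamma q y = Real.exp (L y)) (hd : HasDerivAt L d x) :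
    qDigamma q x = d := by
  have h1 : HasDerivAt (qGamma q) (Real.exp (L x) * d) x := hd.exp.congr_of_eventuallyEq hL
  rw [qDigamma, h1.deriv, hL.self_of_nhds, mul_div_cancel_left₀ _ (Real.exp_ne_zero _)]

theorem one_sub_exp_neg_pos {h s : ℝ} (hh : 0 < h) (hs : 0 < s) :
    0 < 1 - Real.exp (-(h * s)) := by
  have : Real.exp (-(h * s)) < 1 := by
    rw [Real.exp_lt_one_iff]
    exact neg_lt_zero.2 (mul_pos hh hs)
  linarith

theorem sum_qLogStep {h : ℝ} (hh : 0 < h) (N : ℕ) :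
    ∑ n ∈ Finset.range N, qLogStep h n =
      Real.log (1 - Real.exp (-(h * (N + 1)))) - Real.log (1 - Real.exp (-h)) := by
  induction N with
  | zero => simp
  | succ N ih =>
    rw [Finset.sum_range_succ, ih, qLogStep,
      Real.log_div (one_sub_exp_neg_pos hh (by positivity)).ne'
        (one_sub_exp_neg_pos hh (by positivity)).ne']
    push_cast
    ring_nf

theorem tendsto_sum_qLogStep {h : ℝ} (hh : 0 < h) :
    Filter.Tendsto (fun N => ∑ n ∈ Finset.range N, qLogStep h n) Filter.atTop
      (nhds (-Real.log (1 - Real.exp (-h)))) := by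
  simp only [sum_qLogStep hh]
  have h1 : Filter.Tendsto (fun N : ℕ => h * ((N : ℝ) + 1)) Filter.atTop Filter.atTop :=
    (Filter.tendsto_atTop_add_const_right _ _ tendsto_natCast_atTop_atTop).const_mul_atTop hh
  have h2 : Filter.Tendsto (fun N : ℕ => 1 - Real.exp (-(h * ((N : ℝ) + 1)))) Filter.atTop
      (nhds (1 - 0)) :=
    (Real.tendsto_exp_neg_atTop_nhds_zero.comp h1).const_sub 1
  have h3 := (h2.log (by norm_num)).sub_const (Real.log (1 - Real.exp (-h)))
  simpa using h3

theorem summable_qKernel {h x : ℝ} (hh : 0 < h) (hx : 0 < x) :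
    Summable fun n : ℕ => qKernel h (n + x) := by
  have hgeom : Summable fun n : ℕ => qKernel h x * Real.exp (-h) ^ n :=
    (summable_geometric_of_lt_one (Real.exp_pos _).le (by simpa using hh)).mul_left _
  refine Summable.of_nonneg_of_le (fun n => (qKernel_pos hh (by positivity)).le) (fun n => ?_) hgeom
  have hw := exp_mul_sub_one_pos hh hx
  have hw' := exp_mul_sub_one_pos hh (show (0 : ℝ) < n + x by positivity)
  have e1 : Real.exp (h * (n + x)) = Real.exp (h * n) * Real.exp (h * x) := by
    rw [← Real.exp_add]; ring_nf
  have e2 : Real.exp (-h) ^ n = (Real.exp (h * n))⁻¹ := by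
    rw [← Real.exp_nat_mul, ← Real.exp_neg]; ring_nf
  have hr : 1 ≤ Real.exp (h * n) := Real.one_le_exp (by positivity)
  unfold qKernel
  rw [e2, ← div_eq_mul_inv, div_div]
  gcongr
  rw [e1]
  linarith

/-- The logarithms of the factors of the infinite product in `Γ_q`, with `q = e^{-h}`. -/
noncomputable def qLogFactor (h : ℝ) (n : ℕ) (x : ℝ) : ℝ :=
  Real.log ((1 - Real.exp (-(h * (n + 1)))) / (1 - Real.exp (-(h * (n + x)))))

theorem hasDerivAt_qLogFactor {h x : ℝ} (hh : 0 < h) (hx : 0 < x) (n : ℕ) :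
    HasDerivAt (qLogFactor h n) (-qKernel h (n + x)) x := by
  have hs : (0 : ℝ) < n + x := by positivity
  have h0 := one_sub_exp_neg_pos hh (show (0 : ℝ) < n + 1 by positivity)
  have h1 := one_sub_exp_neg_pos hh hs
  have hw := exp_mul_sub_one_pos hh hs
  have h2 := ((hasDerivAt_exp_mul_add (-h) n x).const_sub 1).log
    (by rw [neg_mul]; exact h1.ne')
  have h3 := h2.const_sub (Real.log (1 - Real.exp (-(h * (n + 1)))))
  refine (h3.congr_of_eventuallyEq ?_).congr_deriv ?_
  · filter_upwards [lt_mem_nhds hx] with y hy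
    rw [qLogFactor, Real.log_div h0.ne' (one_sub_exp_neg_pos hh (by positivity)).ne', neg_mul]
  · unfold qKernel
    have e : Real.exp (-h * (n + x)) = (Real.exp (h * (n + x)))⁻¹ := by
      rw [neg_mul, Real.exp_neg]
    have hw' := Real.exp_pos (h * (n + x))
    rw [e]
    generalize Real.exp (h * (n + x)) = w at *
    have : 1 - w⁻¹ = (w - 1) / w := by field_simp
    rw [this]
    field_simp

/-- The infinite product in `Γ_q` is the exponential of a series that can be differentiated term by
term. -/
theorem exp_tsum_qLogFactor {h x : ℝ} (hh : 0 < h) (hx : 0 < x) :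
    Real.exp (∑' n, qLogFactor h n x) =
        ∏' n : ℕ, (1 - Real.exp (-(h * (n + 1)))) / (1 - Real.exp (-(h * (n + x)))) ∧
      HasDerivAt (fun y => ∑' n, qLogFactor h n y) (-∑' n : ℕ, qKernel h (n + x)) x := by
  -- The half-line contains both `x` and the point `1`, at which every term vanishes.
  set δ := min x 1 / 2 with hδ
  have hδ0 : 0 < δ := by positivity
  have hδx : x ∈ Set.Ioi δ := by
    have := min_le_left x 1
    simp only [Set.mem_Ioi]
    linarith
  have hδ1 : (1 : ℝ) ∈ Set.Ioi δ := by
    have := min_le_right x 1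
    simp only [Set.mem_Ioi]
    linarith
  have hd : ∀ (n : ℕ) (y : ℝ), y ∈ Set.Ioi δ →
      HasDerivAt (qLogFactor h n) (-qKernel h (n + y)) y :=
    fun n y hy => hasDerivAt_qLogFactor hh (hδ0.trans hy) n
  have hb : ∀ (n : ℕ) (y : ℝ), y ∈ Set.Ioi δ → ‖-qKernel h (n + y)‖ ≤ qKernel h (n + δ) := by
    intro n y hy
    have hy' : δ < y := hy
    have hy0 : 0 < y := hδ0.trans hy'
    rw [norm_neg, Real.norm_of_nonneg (qKernel_pos hh (by positivity)).le]
    exact qKernel_le_qKernel hh (by positivity) (by linarith)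
  have h1 : Summable fun n => qLogFactor h n 1 := by
    have : ∀ n, qLogFactor h n 1 = 0 := fun n => by
      rw [qLogFactor, div_self (one_sub_exp_neg_pos hh (by positivity)).ne', Real.log_one]
    simp only [this]
    exact summable_zero
  have hs := summable_of_summable_hasDerivAt_of_isPreconnected (summable_qKernel hh hδ0) isOpen_Ioi
    isPreconnected_Ioi hd hb hδ1 h1 hδx
  refine ⟨Real.rexp_tsum_eq_tprod (fun n => ?_) hs, ?_⟩
  · exact div_pos (one_sub_exp_neg_pos hh (by positivity)) (one_sub_exp_neg_pos hh (by positivity))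
  · rw [← tsum_neg]
    exact hasDerivAt_tsum_of_isPreconnected (summable_qKernel hh hδ0) isOpen_Ioi
      isPreconnected_Ioi hd hb hδ1 h1 hδx

theorem tendsto_qPartial {h x : ℝ} (hh : 0 < h) (hx : 0 < x) :
    Filter.Tendsto (fun N => qPartial h N x) Filter.atTop
      (nhds (∑' n : ℕ, qKernel h (n + x) + Real.log (1 - Real.exp (-h)))) := by
  have := (summable_qKernel hh hx).hasSum.tendsto_sum_nat.sub (tendsto_sum_qLogStep hh)
  rw [sub_neg_eq_add] at this
  simpa only [qPartial, Finset.sum_sub_distrib] using this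

theorem qDigamma_of_lt_one {q x : ℝ} (hq : 0 < q) (hq1 : q < 1) (hx : 0 < x) :
    qDigamma q x = -(∑' n : ℕ, qKernel (-Real.log q) (n + x) +
      Real.log (1 - Real.exp (-(-Real.log q)))) := by
  have hh : 0 < -Real.log q := neg_pos.2 (Real.log_neg hq hq1)
  have h1 : 0 < 1 - q := by linarith
  refine qDigamma_eq_of_eventually_eq_exp
    (L := fun y => Real.log (1 - q) * (1 - y) + ∑' n, qLogFactor (-Real.log q) n y) ?_ ?_
  · filter_upwards [lt_mem_nhds hx] with y hy
    rw [Real.exp_add, (exp_tsum_qLogFactor hh hy).1, qGamma, if_pos hq1, Real.rpow_def_of_pos h1]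
    simp only [Real.rpow_def_of_pos hq, neg_mul, neg_neg]
  · refine ((((hasDerivAt_id x).const_sub 1).const_mul _).add
      (exp_tsum_qLogFactor hh hx).2).congr_deriv ?_
    rw [neg_neg, Real.exp_log hq]
    ring

theorem qDigamma_of_one_lt {q x : ℝ} (hq1 : 1 < q) (hx : 0 < x) :
    qDigamma q x = -((∑' n : ℕ, qKernel (Real.log q) (n + x) +
      Real.log (1 - Real.exp (-Real.log q))) - Real.log q * (x - 3 / 2)) := by
  have hh : 0 < Real.log q := Real.log_pos hq1
  have hq : 0 < q := by linarith
  have h1 : 0 < q - 1 := by linarith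
  refine qDigamma_eq_of_eventually_eq_exp
    (L := fun y => Real.log (q - 1) * (1 - y) + Real.log q * (y * (y - 1) / 2) +
      ∑' n, qLogFactor (Real.log q) n y) ?_ ?_
  · filter_upwards [lt_mem_nhds hx] with y hy
    rw [Real.exp_add, Real.exp_add, (exp_tsum_qLogFactor hh hy).1, qGamma, if_neg hq1.not_gt,
      if_neg hq1.ne', Real.rpow_def_of_pos h1]
    simp only [Real.rpow_def_of_pos hq, mul_neg]
  · refine (((((hasDerivAt_id x).const_sub 1).const_mul _).add
      ((((hasDerivAt_id x).mul ((hasDerivAt_id x).sub_const 1)).div_const 2).const_mul _)).add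
      (exp_tsum_qLogFactor hh hx).2).congr_deriv ?_
    have h2 : Real.log (1 - Real.exp (-Real.log q)) = Real.log (q - 1) - Real.log q := by
      rw [← Real.log_div h1.ne' hq.ne', Real.exp_neg, Real.exp_log hq]
      congr 1
      field_simp
    rw [h2]
    simp only [id]
    ring

/-! ### A series for the digamma function -/

theorem hasDerivAt_log_Gamma {x : ℝ} (hx : 0 < x) :
    HasDerivAt (Real.log ∘ Real.Gamma) (deriv Real.Gamma x / Real.Gamma x) x := by
  have : DifferentiableAt ℝ Real.Gamma x :=
    Real.differentiableAt_Gamma fun m hm => by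
      have : (0 : ℝ) ≤ m := m.cast_nonneg
      linarith
  exact this.hasDerivAt.log (Real.Gamma_pos_of_pos hx).ne'

theorem log_Gamma_add_one {x : ℝ} (hx : 0 < x) :
    (Real.log ∘ Real.Gamma) (x + 1) = Real.log x + (Real.log ∘ Real.Gamma) x := by
  simp only [Function.comp]
  rw [Real.Gamma_add_one hx.ne', Real.log_mul hx.ne' (Real.Gamma_pos_of_pos hx).ne']

theorem digamma_add_one {x : ℝ} (hx : 0 < x) :
    deriv Real.Gamma (x + 1) / Real.Gamma (x + 1) = deriv Real.Gamma x / Real.Gamma x + 1 / x := by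
  have h1 : HasDerivAt (fun y => (Real.log ∘ Real.Gamma) (y + 1))
      (deriv Real.Gamma (x + 1) / Real.Gamma (x + 1)) x :=
    (hasDerivAt_log_Gamma (show 0 < x + 1 by linarith)).comp_add_const x 1
  have h2 := (Real.hasDerivAt_log hx.ne').add (hasDerivAt_log_Gamma hx)
  have h3 : (fun y => (Real.log ∘ Real.Gamma) (y + 1)) =ᶠ[nhds x]
      Real.log + Real.log ∘ Real.Gamma := by
    filter_upwards [lt_mem_nhds hx] with y hy using log_Gamma_add_one hy
  rw [h1.unique (h2.congr_of_eventuallyEq h3)]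
  ring

/-- By convexity of `log Γ`, its derivative at `x` and at `x + 1` is separated by the slope
`log x`. -/
theorem digamma_le_log_le_digamma_add_one {x : ℝ} (hx : 0 < x) :
    deriv Real.Gamma x / Real.Gamma x ≤ Real.log x ∧
      Real.log x ≤ deriv Real.Gamma (x + 1) / Real.Gamma (x + 1) := by
  have hx1 : 0 < x + 1 := by linarith
  have hs : slope (Real.log ∘ Real.Gamma) x (x + 1) = Real.log x := by
    rw [slope_def_field, log_Gamma_add_one hx]
    ring
  rw [← hs]
  exact ⟨Real.convexOn_log_Gamma.le_slope_of_hasDerivAt hx hx1 (by linarith)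
      (hasDerivAt_log_Gamma hx),
    Real.convexOn_log_Gamma.slope_le_of_hasDerivAt hx hx1 (by linarith)
      (hasDerivAt_log_Gamma hx1)⟩

theorem digammaPartial_eq {x : ℝ} (hx : 0 < x) (N : ℕ) :
    digammaPartial N x = deriv Real.Gamma (x + N) / Real.Gamma (x + N) - Real.log (N + 1) -
      deriv Real.Gamma x / Real.Gamma x := by
  induction N with
  | zero => simp [digammaPartial]
  | succ N ih =>
    rw [digammaPartial, Finset.sum_range_succ, ← digammaPartial, ih,
      Real.log_div (by positivity) (by positivity)]
    have := digamma_add_one (show 0 < x + N by positivity)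
    push_cast
    rw [← add_assoc, this]
    ring_nf

theorem tendsto_log_add_sub_log (a : ℝ) :
    Filter.Tendsto (fun N : ℕ => Real.log (a + N) - Real.log (N + 1)) Filter.atTop (nhds 0) := by
  have h1 : Filter.Tendsto (fun N : ℕ => 1 + (a - 1) * (1 / ((N : ℝ) + 1))) Filter.atTop
      (nhds (1 + (a - 1) * 0)) :=
    (tendsto_one_div_add_atTop_nhds_zero_nat.const_mul _).const_add 1
  have h2 := h1.log (by norm_num)
  simp only [mul_zero, add_zero, Real.log_one] at h2
  refine h2.congr' ?_
  filter_upwards [tendsto_natCast_atTop_atTop.eventually_gt_atTop (-a)] with N hN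
  rw [← Real.log_div (by linarith) (by positivity)]
  congr 1
  field_simp
  ring

theorem tendsto_digammaPartial {x : ℝ} (hx : 0 < x) :
    Filter.Tendsto (fun N => digammaPartial N x) Filter.atTop (nhds (-qDigamma 1 x)) := by
  have hG : qGamma 1 = Real.Gamma := by
    funext y
    simp [qGamma]
  have h1 : Filter.Tendsto (fun N : ℕ => deriv Real.Gamma (x + N) / Real.Gamma (x + N) -
      Real.log (N + 1)) Filter.atTop (nhds 0) := by
    refine tendsto_of_tendsto_of_tendsto_of_le_of_le' (tendsto_log_add_sub_log (x - 1))
      (tendsto_log_add_sub_log x) ?_ ?_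
    · filter_upwards [Filter.eventually_ge_atTop 1] with N hN
      have hN' : (1 : ℝ) ≤ N := by exact_mod_cast hN
      have := (digamma_le_log_le_digamma_add_one (show 0 < x - 1 + N by linarith)).2
      rw [show x - 1 + N + 1 = x + N by ring] at this
      linarith
    · refine Filter.Eventually.of_forall fun N => ?_
      have := (digamma_le_log_le_digamma_add_one (show 0 < x + N by positivity)).1
      linarith
  simp only [digammaPartial_eq hx, qDigamma, hG]
  simpa using h1.sub_const (deriv Real.Gamma x / Real.Gamma x)

theorem mainTheorem6 (q x : ℝ) (hq : 0 < q) (hx : 0 < x) :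
    qDigamma q x * qDigamma q (1 / x) ≤ (qDigamma q 1) ^ 2 := by
  have hx' : 0 < 1 / x := by positivity
  rcases lt_trichotomy q 1 with hq1 | rfl | hq1
  · have hh : 0 < -Real.log q := neg_pos.2 (Real.log_neg hq hq1)
    rw [qDigamma_of_lt_one hq hq1 hx, qDigamma_of_lt_one hq hq1 hx',
      qDigamma_of_lt_one hq hq1 one_pos, neg_mul_neg, neg_sq]
    exact le_of_tendsto_of_tendsto' ((tendsto_qPartial hh hx).mul (tendsto_qPartial hh hx'))
      ((tendsto_qPartial hh one_pos).pow 2) fun N => qPartial_mul_le_sq hh hx N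
  · rw [← neg_mul_neg, ← neg_sq (qDigamma 1 1)]
    exact le_of_tendsto_of_tendsto'
      ((tendsto_digammaPartial hx).mul (tendsto_digammaPartial hx'))
      ((tendsto_digammaPartial one_pos).pow 2) fun N => digammaPartial_mul_le_sq hx N
  · have hh : 0 < Real.log q := Real.log_pos hq1
    have lim : ∀ y, 0 < y → Filter.Tendsto
        (fun N => qPartial (Real.log q) (N + 1) y - Real.log q * (y - 3 / 2)) Filter.atTop
        (nhds (-qDigamma q y)) := by
      intro y hy
      rw [qDigamma_of_one_lt hq1 hy, neg_neg]
      exact ((tendsto_qPartial hh hy).comp (Filter.tendsto_add_atTop_nat 1)).sub_const _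
    rw [← neg_mul_neg, ← neg_sq (qDigamma q 1)]
    exact le_of_tendsto_of_tendsto' ((lim x hx).mul (lim _ hx')) ((lim 1 one_pos).pow 2)
      fun N => qPartial_sub_mul_le_sq hh hx N
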